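/- Let $\mathfrak g$ be a finite-dimensional simple complex Lie algebra with Killing form $K$, $\mathfrak h$ a Cartan subalgebra, $R$ the set of roots, $\mathfrak g_\beta$ the root space of $\beta\in R$, $\Gamma$ a set of simple roots, $\alpha_{\max}=\sum_{\gamma\in\Gamma}k_\gamma\gamma$ the highest root. Fix $\alpha\in\Gamma$ and put $k=k_\alpha$. Let $h_\alpha\in\mathfrak h$ be given by $\alpha(h_\alpha)=1/k$ and $\gamma(h_\alpha)=0$ for $\gamma\in\Gamma\setminus\{\alpha\}$, and let $$\mathbb O_\alpha=\mathfrak h[[u^{-1}]]\oplus\bigoplus_{\beta\in R}M_\beta\otimes\mathfrak g_\beta\subseteq\mathfrak g((u^{-1})),\qquad M_\beta=\{f\in\mathbb C((u^{-1})): v(f)\ge\beta(h_\alpha)\},$$ where $v\big(\sum_{j\ge n}a_ju^{-j}\big)=n$ if $a_n\neq0$ (and $v(0)=\infty$). Let $P_\alpha^-$ be the parabolic subalgebra spanned by $\mathfrak h$, the root spaces of all negative roots and those of all positive roots in which $\alpha$ has coefficient $0$, and let $(P_\alpha^-)^\perp$ be its orthogonal complement in $\mathfrak g$ with respect to $K$.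 Let $\mathfrak g[\varepsilon]=\mathfrak g\oplus\varepsilon\mathfrak g$ with $\varepsilon^2=0$, with the form $\bar Q_\varepsilon(x_1+\varepsilon x_2,y_1+\varepsilon y_2)=K(x_1,y_2)+K(x_2,y_1)$. On the Lie algebra $\mathfrak g((u))\oplus\mathfrak g[\varepsilon]$ consider the form (the case $a(u)=1$) $$Q(f_1+x_2+\varepsilon x_3,\,f_2+y_2+\varepsilon y_3)=\mathrm{Res}_{u=0}\big(u^{-2}K(f_1,f_2)\big)-K(x_3,y_2)-K(x_2,y_3),$$ where in the first term $K$ is the Killing form of $\mathfrak g((u))$ over $\mathbb C((u))$, and regard $\mathfrak g[[u]]$ as a subalgebra through the embedding $f\mapsto(f,\,f(0)+\varepsilon f'(0))$. A Lie subalgebra (over $\mathbb C$) $W$ is called Lagrangian if $W=W^\perp$ for the form in question, and transversal to a subspace $X$ if the ambient space is the direct sum of $W$ and $X$. (i) If $k=1$, then the map $W\mapsto\{z\in\mathfrak g[\varepsilon]: (f,z)\in W\text{ for some }f\in\mathfrak g((u))\}$ is a bijection from the set of Lagrangian subalgebras $W$ of $\mathfrak g((u))\oplus\mathfrak g[\varepsilon]$,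 with respect to $Q$, which are transversal to $\mathfrak g[[u]]$ and satisfy $W\subseteq(\mathbb O_\alpha\cap\mathfrak g[u,u^{-1}])\oplus\mathfrak g[\varepsilon]$, onto the set of Lagrangian subalgebras of $\mathfrak g[\varepsilon]$, with respect to $\bar Q_\varepsilon$, which are transversal to $P_\alpha^-+\varepsilon(P_\alpha^-)^\perp$. (ii) If $k>1$, there are no Lagrangian subalgebras $W$ of $\mathfrak g((u))\oplus\mathfrak g[\varepsilon]$, with respect to $Q$, which are transversal to $\mathfrak g[[u]]$ and satisfy $W\subseteq(\mathbb O_\alpha\cap\mathfrak g[u,u^{-1}])\oplus\mathfrak g[\varepsilon]$. -/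

import Mathlib

open scoped TensorProduct DualNumber LaurentPolynomial

/- `ℂ((u))` carries its standard `ℂ`-algebra structure. -/
attribute [local instance 2000] HahnSeries.instAlgebra

noncomputable section

namespace PolyBialg

open LieAlgebra LieAlgebra.IsKilling

/-! ### Generalities on Lie algebras with a bilinear form -/

section Lagrangian

variable {D : Type*} [LieRing D] [LieAlgebra ℂ D]

/-- A Lie subalgebra `W` is Lagrangian for the bilinear form `Q` if `W = W^⊥`. -/
def IsLagrangian (Q : LinearMap.BilinForm ℂ D) (W : LieSubalgebra ℂ D) : Prop :=
  Q.orthogonal W.toSubmodule = W.toSubmodule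

/-- A Lie subalgebra `W` is transversal to the subspace `X` if the ambient space is `W ⊕ X`. -/
def IsTransversal (W : LieSubalgebra ℂ D) (X : Submodule ℂ D) : Prop :=
  IsCompl W.toSubmodule X

end Lagrangian

/-! ### Roots, marks, vertices of the standard simplex, parabolic subalgebras -/

section Roots

variable {g : Type*} [LieRing g] [LieAlgebra ℂ g] [Module.Finite ℂ g] [LieAlgebra.IsSimple ℂ g]
  {H : LieSubalgebra ℂ g} [H.IsCartanSubalgebra]

/-- `θ` is the highest root with respect to the set of simple roots `b`: for every root `β`,
the difference `θ - β` is a sum of simple roots. -/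
def IsHighestRoot (b : (rootSystem H).Base) (θ : H.root) : Prop :=
  ∀ β : H.root, (rootSystem H).root θ - (rootSystem H).root β ∈
    AddSubmonoid.closure ((rootSystem H).root '' b.support)

/-- The vertex of the standard simplex corresponding to the simple root `α`, where `k` is the family
of marks: the element `h` of the Cartan subalgebra with `α(h) = 1 / k α` and `γ(h) = 0` for all other
simple roots `γ` (see the two lemmas below). -/
def simplexVertex (b : (rootSystem H).Base) (k : b.support → ℕ) (α : b.support) : H :=
  (k α : ℂ)⁻¹ • (Module.evalEquiv ℂ H).symm (b.toWeightBasis.coord α)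

lemma root_simplexVertex (b : (rootSystem H).Base) (k : b.support → ℕ) (α γ : b.support) :
    (rootSystem H).root γ (simplexVertex b k α) = (k α : ℂ)⁻¹ * Finsupp.single γ (1 : ℂ) α := by
  have h : ∀ f : Module.Dual ℂ H, f ((Module.evalEquiv ℂ H).symm (b.toWeightBasis.coord α)) =
      b.toWeightBasis.coord α f := fun f => by
    rw [← Module.Dual.eval_apply ℂ H, ← Module.evalEquiv_toLinearMap ℂ H]
    simp
  rw [simplexVertex, map_smul, h, Module.Basis.coord_apply]
  rw [b.toWeightBasis_repr_root γ]
  simp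

lemma root_simplexVertex_self (b : (rootSystem H).Base) (k : b.support → ℕ) (α : b.support) :
    (rootSystem H).root α (simplexVertex b k α) = (k α : ℂ)⁻¹ := by
  simp [root_simplexVertex, -rootSystem_root_apply]

lemma root_simplexVertex_of_ne (b : (rootSystem H).Base) (k : b.support → ℕ) {α γ : b.support}
    (hne : γ ≠ α) : (rootSystem H).root γ (simplexVertex b k α) = 0 := by
  simp [root_simplexVertex, hne, -rootSystem_root_apply]

/-- The standard parabolic subalgebra `P_α^-`: the sum of the Cartan subalgebra, the root spaces of
all negative roots, and the root spaces of all positive roots which do not contain `α`. -/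
def negParabolic (b : (rootSystem H).Base) (α : b.support) : Submodule ℂ g :=
  H.toSubmodule ⊔ ⨆ β : H.root,
    ⨆ _ : ¬ b.IsPos β ∨ b.toWeightBasis.repr ((rootSystem H).root β) α = 0,
      (rootSpace H β.1).toSubmodule

end Roots

/-! ### Current algebras -/

/-- The inclusion `ℂ[u, u⁻¹] → ℂ((u))`. -/
def laurentAtZero : ℂ[T;T⁻¹] →ₐ[ℂ] LaurentSeries ℂ :=
  AddMonoidAlgebra.lift ℂ (LaurentSeries ℂ) ℤ
    { toFun := fun n => HahnSeries.single n.toAdd 1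
      map_one' := rfl
      map_mul' := fun m n => by simp }

/-- The inclusion `ℂ[u, u⁻¹] → ℂ((u⁻¹))`. The field `ℂ((u⁻¹))` is modelled by Laurent series in the
variable `t = u⁻¹`, so that `u` is sent to `t⁻¹`. -/
def laurentAtInfinity : ℂ[T;T⁻¹] →ₐ[ℂ] LaurentSeries ℂ :=
  laurentAtZero.comp (LaurentPolynomial.invert (R := ℂ)).toAlgHom

/-- The truncation `ℂ[[u]] → ℂ[ε]`, `f ↦ f(0) + f'(0) ε`. -/
def truncate : PowerSeries ℂ →ₗ[ℂ] ℂ[ε] where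
  toFun f := TrivSqZeroExt.inl (PowerSeries.coeff 0 f) + TrivSqZeroExt.inr (PowerSeries.coeff 1 f)
  map_add' f f' := by ext <;> simp
  map_smul' c f := by ext <;> simp

section Current

variable (g : Type*) [LieRing g] [LieAlgebra ℂ g]

/-- `𝔤((u)) = ℂ((u)) ⊗ 𝔤`. The same type, with `t = u⁻¹` as variable, is used for `𝔤((u⁻¹))`. -/
abbrev LaurentCurrent := LaurentSeries ℂ ⊗[ℂ] g

/-- `𝔤[ε] = ℂ[ε] ⊗ 𝔤`, with `ε² = 0`. -/
abbrev DualCurrent := ℂ[ε] ⊗[ℂ] g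

/-- The Lie algebra `𝔤((u)) ⊕ 𝔤[ε]`. -/
abbrev Double := LaurentCurrent g × DualCurrent g

variable {g}

/-- The component `x` of the element `x + ε y` of `𝔤[ε]`. -/
def dualFst : DualCurrent g →ₗ[ℂ] g :=
  (TensorProduct.lid ℂ g).toLinearMap ∘ₗ LinearMap.rTensor g (TrivSqZeroExt.fstHom ℂ ℂ ℂ).toLinearMap

/-- The component `y` of the element `x + ε y` of `𝔤[ε]`. -/
def dualSnd : DualCurrent g →ₗ[ℂ] g :=
  (TensorProduct.lid ℂ g).toLinearMap ∘ₗ LinearMap.rTensor g (TrivSqZeroExt.sndHom ℂ ℂ)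

variable (g)

/-- The form `Q̄_ε(x₁ + ε x₂, y₁ + ε y₂) = K(x₁, y₂) + K(x₂, y₁)` on `𝔤[ε]`. -/
def dualForm : LinearMap.BilinForm ℂ (DualCurrent g) :=
  (killingForm ℂ g).compl₁₂ dualFst dualSnd + (killingForm ℂ g).compl₁₂ dualSnd dualFst

/-- The form `(f₁, f₂) ↦ Res_{u = 0} (u⁻² a(u) K(f₁, f₂))` on `𝔤((u))`, where `K` is the Killing form
of `𝔤((u))` over `ℂ((u))`. -/
def residueForm (a : PowerSeries ℂ) : LinearMap.BilinForm ℂ (LaurentCurrent g) :=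
  LinearMap.mk₂ ℂ
    (fun f₁ f₂ => HahnSeries.coeff (HahnSeries.single (-2 : ℤ) (1 : ℂ) *
      HahnSeries.ofPowerSeries ℤ ℂ a *
        killingForm (LaurentSeries ℂ) (LaurentCurrent g) f₁ f₂) (-1))
    (fun f f' h => by simp [mul_add])
    (fun c f h => by
      rw [← algebraMap_smul (LaurentSeries ℂ) c f, map_smul, LinearMap.smul_apply, smul_eq_mul,
        mul_left_comm, ← Algebra.smul_def, HahnSeries.coeff_smul])
    (fun f h h' => by simp [mul_add])
    (fun c f h => by
      rw [← algebraMap_smul (LaurentSeries ℂ) c h, map_smul, smul_eq_mul,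
        mul_left_comm, ← Algebra.smul_def, HahnSeries.coeff_smul])

/-- The form `Q_{a(u)}` on the double `𝔤((u)) ⊕ 𝔤[ε]`:
`(f₁ + x₂ + ε x₃, f₂ + y₂ + ε y₃) ↦ Res_{u = 0} (u⁻² a(u) K(f₁, f₂)) - K(x₃, y₂) - K(x₂, y₃)`. -/
def doubleForm (a : PowerSeries ℂ) : LinearMap.BilinForm ℂ (Double g) :=
  (residueForm g a).compl₁₂ (LinearMap.fst ℂ _ _) (LinearMap.fst ℂ _ _) -
    (dualForm g).compl₁₂ (LinearMap.snd ℂ _ _) (LinearMap.snd ℂ _ _)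

/-- The subalgebra `𝔤[[u]]` of the double: it is embedded diagonally, by
`f ↦ (f, f(0) + ε f'(0))`. -/
def powerSeriesCurrent : Submodule ℂ (Double g) :=
  LinearMap.range
    ((LinearMap.rTensor g (HahnSeries.ofPowerSeriesAlg ℤ ℂ (A := ℂ)).toLinearMap).prod
      (LinearMap.rTensor g truncate))

variable {g}

/-- The subspace `P + ε P^⊥` of `𝔤[ε]`, where `P^⊥` is the orthogonal complement for the Killing
form. -/
def dualExtension (P : Submodule ℂ g) : Submodule ℂ (DualCurrent g) :=
  P.comap dualFst ⊓ ((killingForm ℂ g).orthogonal P).comap dualSnd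

end Current

/-! ### Maximal orders -/

/-- The subspace `{f ∈ ℂ((u⁻¹)) : v(f) ≥ r}`, where `v` is the `u⁻¹`-adic valuation. -/
def valuationGE (r : ℝ) : Submodule ℂ (LaurentSeries ℂ) where
  carrier := {f | ∀ n : ℤ, (n : ℝ) < r → f.coeff n = 0}
  zero_mem' := by simp
  add_mem' hf hf' n hn := by simp [hf n hn, hf' n hn]
  smul_mem' c f hf n hn := by simp [hf n hn]

section Orders

variable {g : Type*} [LieRing g] [LieAlgebra ℂ g] [Module.Finite ℂ g] [LieAlgebra.IsSimple ℂ g]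
  {H : LieSubalgebra ℂ g} [H.IsCartanSubalgebra]

/-- The subspace `𝕆_h = 𝔥[[u⁻¹]] ⊕ ⨁_β M_β(h) ⊗ 𝔤_β` of `𝔤((u⁻¹))`, for `h` in the Cartan subalgebra
on which all roots `β` take real values, with `M_β(h) = {f : v(f) ≥ β(h)}`. -/
def maximalOrder (h : H) : Submodule ℂ (LaurentCurrent g) :=
  Submodule.map₂ (TensorProduct.mk ℂ (LaurentSeries ℂ) g) (valuationGE 0) H.toSubmodule ⊔
    ⨆ β : H.root, Submodule.map₂ (TensorProduct.mk ℂ (LaurentSeries ℂ) g)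
      (valuationGE (((rootSystem H).root β h).re)) (rootSpace H β.1).toSubmodule

/-- `𝕆_α ∩ 𝔤[u, u⁻¹]`, as a subspace of `𝔤((u))`; here `𝕆_α = 𝕆_h` for the vertex `h` of the standard
simplex corresponding to `α`. -/
def polynomialOrder (b : (rootSystem H).Base) (k : b.support → ℕ) (α : b.support) :
    Submodule ℂ (LaurentCurrent g) :=
  ((maximalOrder (simplexVertex b k α)).comap
    (LinearMap.rTensor g laurentAtInfinity.toLinearMap)).map
      (LinearMap.rTensor g laurentAtZero.toLinearMap)

end Orders

end PolyBialg

end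

/-! Write `X` for `𝕆_α ∩ 𝔤[u, u⁻¹]`. The residue form pairs the coefficient of `u^i` with that of
`u^(1-i)` through the Killing form. A Lagrangian `W` inside `X ⊕ 𝔤[ε]` contains `X^⊥ ⊕ 0`, since `W
= W^⊥` (`mem_of_forall_residueForm_eq_zero`). Everything therefore depends on how `X^⊥` compares
with `X`.

Grade `𝔤` by the coefficient of `α` in a root; let `F_j` be the part of degree at most `j`.
Invariance and nondegeneracy of the Killing form give `F_j^⊥ = F_(-j-1)` (`mem_rootFiltration_iff`).

If `k = 1`, the degrees are `-1, 0, 1`, and `X` consists of the currents whose `i`-th coefficient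
lies in `F_(-i)`. Hence `X` is a subalgebra with `X^⊥ = X` (`isLagrangian_polynomialOrder`), so `W =
X ⊕ V` with `V` the projection of `W` (`eq_prodSubalgebra`), and `W` is Lagrangian exactly when `V`
is. The currents in `X ∩ 𝔤[[u]]` have the form `x + yu` with `x ∈ F_0 = P_α^-` and `y ∈ F_(-1) =
(P_α^-)^⊥`, which turns transversality of `W` into that of `V`
(`isTransversal_prod_polynomialOrder_iff`).

If `k > 1`, then `0 < α(h_α) < 1`. A nonzero constant current in `𝔤_α` is orthogonal to `X` but not
in `X`, so no `W` exists (`exists_not_mem_polynomialOrder`). -/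

noncomputable section

namespace PolyBialg

open LieAlgebra LieAlgebra.IsKilling

/-! ### Coefficients of currents -/

section Coefficients

variable {g : Type*} [LieRing g] [LieAlgebra ℂ g]

/-- The `ℂ`-linear map sending a Laurent series to its `i`-th coefficient. -/
def laurentCoeff (i : ℤ) : LaurentSeries ℂ →ₗ[ℂ] ℂ where
  toFun f := f.coeff i
  map_add' f f' := by simp
  map_smul' c f := by simp

@[simp] lemma laurentCoeff_apply (i : ℤ) (f : LaurentSeries ℂ) : laurentCoeff i f = f.coeff i := rfl

variable (g) in
/-- The `i`-th coefficient of an element of `𝔤((u))`. -/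
def currentCoeff (i : ℤ) : LaurentCurrent g →ₗ[ℂ] g :=
  (TensorProduct.lid ℂ g).toLinearMap ∘ₗ LinearMap.rTensor g (laurentCoeff i)

@[simp] lemma currentCoeff_tmul (i : ℤ) (f : LaurentSeries ℂ) (x : g) :
    currentCoeff g i (f ⊗ₜ x) = f.coeff i • x := by
  simp [currentCoeff]

/-- The monomial `x u^i`, as a linear function of `x`. -/
def monomial (i : ℤ) : g →ₗ[ℂ] LaurentCurrent g :=
  TensorProduct.mk ℂ (LaurentSeries ℂ) g (HahnSeries.single i 1)

lemma monomial_apply (i : ℤ) (x : g) :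
    monomial i x = (HahnSeries.single i (1 : ℂ) : LaurentSeries ℂ) ⊗ₜ[ℂ] x := rfl

lemma currentCoeff_monomial (i j : ℤ) (x : g) :
    currentCoeff g i (monomial j x) = if i = j then x else 0 := by
  rw [monomial_apply, currentCoeff_tmul, HahnSeries.coeff_single]
  split_ifs <;> simp

lemma lie_monomial (i j : ℤ) (x y : g) :
    ⁅monomial i x, monomial j y⁆ = monomial (i + j) ⁅x, y⁆ := by
  simp [monomial_apply]

/-- In a basis of `𝔤` a current is a finite family of Laurent series, and their coefficients are the
coordinates of its coefficients. -/
lemma current_ext [Module.Finite ℂ g] {F G : LaurentCurrent g}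
    (h : ∀ i, currentCoeff g i F = currentCoeff g i G) : F = G := by
  let B := Module.finBasis ℂ g
  have key : ∀ (F : LaurentCurrent g) (i : ℤ) (j),
      (TensorProduct.equivFinsuppOfBasisRight B F j).coeff i = B.repr (currentCoeff g i F) j := by
    intro F i j
    induction F using TensorProduct.induction_on with
    | zero => simp
    | tmul f x =>
      simp [mul_comm]
    | add F G hF hG => simp [hF, hG]
  apply (TensorProduct.equivFinsuppOfBasisRight B).injective
  ext j i
  rw [key, key, h]

lemma exists_currentCoeff_eq_zero (F : LaurentCurrent g) :
    ∃ N : ℤ, ∀ i < N, currentCoeff g i F = 0 := by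
  induction F using TensorProduct.induction_on with
  | zero => exact ⟨0, by simp⟩
  | tmul f x =>
    refine ⟨f.order, fun i hi => ?_⟩
    rw [currentCoeff_tmul, HahnSeries.coeff_eq_zero_of_lt_order hi, zero_smul]
  | add F G hF hG =>
    obtain ⟨N, hN⟩ := hF
    obtain ⟨M, hM⟩ := hG
    refine ⟨min N M, fun i hi => ?_⟩
    rw [map_add, hN i (hi.trans_le (min_le_left _ _)), hM i (hi.trans_le (min_le_right _ _)),
      add_zero]

/-- Used to reduce brackets and residues of currents bounded above in degree to monomials. -/
lemma exists_sum_monomial [Module.Finite ℂ g] (F : LaurentCurrent g) (M : ℤ)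
    (hM : ∀ i > M, currentCoeff g i F = 0) :
    ∃ N : ℤ, F = ∑ i ∈ Finset.Icc N M, monomial i (currentCoeff g i F) := by
  obtain ⟨N, hN⟩ := exists_currentCoeff_eq_zero F
  refine ⟨N, current_ext fun j => ?_⟩
  simp only [map_sum, currentCoeff_monomial, Finset.sum_ite_eq, Finset.mem_Icc]
  split_ifs with h
  · rfl
  · by_cases hj : j < N
    · exact hN j hj
    · exact hM j (by grind)

/-! ### The residue form -/

section Form

lemma residueForm_comm (F G : LaurentCurrent g) : residueForm g 1 F G = residueForm g 1 G F := by
  simp only [residueForm, LinearMap.mk₂_apply]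
  rw [LieModule.traceForm_comm]

variable [Module.Finite ℂ g]

lemma killingForm_tmul_tmul (f₁ f₂ : LaurentSeries ℂ) (x y : g) :
    killingForm (LaurentSeries ℂ) (LaurentCurrent g) (f₁ ⊗ₜ x) (f₂ ⊗ₜ y) =
      (f₁ * f₂) * algebraMap ℂ (LaurentSeries ℂ) (killingForm ℂ g x y) := by
  have h₁ : ∀ (f : LaurentSeries ℂ) (x : g), f ⊗ₜ[ℂ] x = f • ((1 : LaurentSeries ℂ) ⊗ₜ[ℂ] x) :=
    fun f x => by rw [TensorProduct.smul_tmul', smul_eq_mul, mul_one]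
  have h₂ : killingForm (LaurentSeries ℂ) (LaurentCurrent g) (1 ⊗ₜ x) (1 ⊗ₜ y) =
      algebraMap ℂ (LaurentSeries ℂ) (killingForm ℂ g x y) := by
    have := LieModule.traceForm_baseChange ℂ g g (LaurentSeries ℂ)
    rw [killingForm, this]
    simp [LinearMap.BilinForm.baseChange_tmul, Algebra.algebraMap_eq_smul_one]
  rw [h₁ f₁, h₁ f₂, map_smul, map_smul, LinearMap.smul_apply, h₂]
  simp only [smul_eq_mul]
  ring

/-- The residue of `u⁻² u^i u^j` is nonzero only for `i + j = 1`. -/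
lemma residueForm_monomial (F : LaurentCurrent g) (j : ℤ) (x : g) :
    residueForm g 1 F (monomial j x) = killingForm ℂ g (currentCoeff g (1 - j) F) x := by
  induction F using TensorProduct.induction_on with
  | zero => simp
  | tmul f y =>
    rw [monomial_apply]
    simp only [residueForm, LinearMap.mk₂_apply, killingForm_tmul_tmul, currentCoeff_tmul]
    rw [map_one (HahnSeries.ofPowerSeries ℤ ℂ), mul_one, mul_comm f, mul_assoc, ← mul_assoc,
      HahnSeries.single_mul_single, ← mul_assoc, mul_comm _ (algebraMap ℂ (LaurentSeries ℂ) _),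
      ← Algebra.smul_def,
      HahnSeries.coeff_smul]
    have := HahnSeries.coeff_single_mul_add (R := ℂ) (r := 1) (x := f) (a := 1 - j) (b := -2 + j)
    rw [show 1 - j + (-2 + j) = -1 by ring] at this
    rw [mul_one, this]
    simp [mul_comm]
  | add F G hF hG => simp only [map_add, LinearMap.add_apply, hF, hG]

end Form

/-! ### The embedding of `𝔤[[u]]` -/

lemma dualFst_tmul (c : ℂ[ε]) (x : g) : dualFst (c ⊗ₜ[ℂ] x) = TrivSqZeroExt.fst c • x := by
  simp [dualFst]

lemma dualSnd_tmul (c : ℂ[ε]) (x : g) : dualSnd (c ⊗ₜ[ℂ] x) = TrivSqZeroExt.snd c • x := by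
  simp [dualSnd]

lemma dual_ext {z w : DualCurrent g} (h₁ : dualFst z = dualFst w) (h₂ : dualSnd z = dualSnd w) :
    z = w := by
  have key : ∀ z : DualCurrent g, z = (1 : ℂ[ε]) ⊗ₜ[ℂ] dualFst z + (ε : ℂ[ε]) ⊗ₜ[ℂ] dualSnd z := by
    intro z
    induction z using TensorProduct.induction_on with
    | zero => simp
    | tmul c x =>
      rw [dualFst_tmul, dualSnd_tmul, ← TensorProduct.smul_tmul, ← TensorProduct.smul_tmul,
        ← TensorProduct.add_tmul]
      congr 1
      ext <;> simp
    | add z w hz hw =>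
      rw [map_add, map_add, TensorProduct.tmul_add, TensorProduct.tmul_add]
      nth_rw 1 [hz, hw]
      abel
  rw [key z, key w, h₁, h₂]

lemma coeff_ofPowerSeries (p : PowerSeries ℂ) (n : ℕ) :
    (HahnSeries.ofPowerSeries ℤ ℂ p).coeff (n : ℤ) = PowerSeries.coeff n p := by
  exact HahnSeries.ofPowerSeries_apply_coeff p n

lemma coeff_ofPowerSeries_of_neg (p : PowerSeries ℂ) {i : ℤ} (hi : i < 0) :
    (HahnSeries.ofPowerSeries ℤ ℂ p).coeff i = 0 := by
  rw [HahnSeries.ofPowerSeries_apply]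
  apply HahnSeries.embDomain_of_notMem_range
  rintro ⟨n, hn⟩
  simp at hn
  omega

lemma ofPowerSeriesAlg_eq (p : PowerSeries ℂ) :
    HahnSeries.ofPowerSeriesAlg ℤ ℂ (A := ℂ) p = HahnSeries.ofPowerSeries ℤ ℂ p := rfl

lemma coeffs_of_mem_powerSeriesCurrent {F : LaurentCurrent g} {z : DualCurrent g}
    (h : (F, z) ∈ powerSeriesCurrent g) :
    (∀ i < 0, currentCoeff g i F = 0) ∧ currentCoeff g 0 F = dualFst z ∧
      currentCoeff g 1 F = dualSnd z := by
  obtain ⟨P, hP⟩ := h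
  obtain ⟨rfl, rfl⟩ := Prod.mk.inj hP
  clear hP
  induction P using TensorProduct.induction_on with
  | zero => simp
  | tmul p x =>
    have h0 := coeff_ofPowerSeries p 0
    have h1 := coeff_ofPowerSeries p 1
    simp only [Nat.cast_zero, Nat.cast_one] at h0 h1
    simp only [LinearMap.rTensor_tmul, AlgHom.toLinearMap_apply, ofPowerSeriesAlg_eq,
      currentCoeff_tmul, dualFst_tmul, dualSnd_tmul, h0, h1]
    refine ⟨fun i hi => by rw [coeff_ofPowerSeries_of_neg p hi, zero_smul], ?_, ?_⟩ <;>
      simp [truncate]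
  | add P P' h h' =>
    simp only [map_add]
    refine ⟨fun i hi => ?_, ?_, ?_⟩
    · rw [h.1 i hi, h'.1 i hi, add_zero]
    · rw [h.2.1, h'.2.1]
    · rw [h.2.2, h'.2.2]

lemma monomial_add_monomial_mem_powerSeriesCurrent (z : DualCurrent g) :
    (monomial 0 (dualFst z) + monomial 1 (dualSnd z), z) ∈ powerSeriesCurrent g := by
  refine ⟨(1 : PowerSeries ℂ) ⊗ₜ dualFst z + (PowerSeries.X : PowerSeries ℂ) ⊗ₜ dualSnd z, ?_⟩
  refine Prod.ext ?_ (dual_ext ?_ ?_)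
  · simp [ofPowerSeriesAlg_eq, monomial_apply, -HahnSeries.ofPowerSeriesAlg_apply_coeff]
  · simp [dualFst_tmul, truncate]
  · simp [dualSnd_tmul, truncate]

/-- Splits off the principal part: `𝔤((u)) = 𝔤[[u]] + u⁻¹𝔤[u⁻¹]`. -/
lemma exists_mem_powerSeriesCurrent [Module.Finite ℂ g] (F : LaurentCurrent g) :
    ∃ p : Double g, p ∈ powerSeriesCurrent g ∧
      F - p.1 ∈ ⨆ i : {i : ℤ // i < 0}, LinearMap.range (monomial (g := g) i) := by
  induction F using TensorProduct.induction_on with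
  | zero => exact ⟨0, zero_mem _, by simp⟩
  | tmul f x =>
    let p : PowerSeries ℂ := PowerSeries.mk fun n => f.coeff n
    refine ⟨_, ⟨p ⊗ₜ x, rfl⟩, ?_⟩
    have hp : ∀ i > (-1 : ℤ), currentCoeff g i
        (f ⊗ₜ x - (HahnSeries.ofPowerSeries ℤ ℂ p) ⊗ₜ[ℂ] x) = 0 := by
      intro i hi
      lift i to ℕ using by omega
      rw [map_sub, currentCoeff_tmul, currentCoeff_tmul, coeff_ofPowerSeries, PowerSeries.coeff_mk,
        sub_self]
    obtain ⟨N, hN⟩ := exists_sum_monomial _ _ hp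
    simp only [LinearMap.prod_apply, Function.prod, LinearMap.rTensor_tmul,
      AlgHom.toLinearMap_apply, ofPowerSeriesAlg_eq]
    rw [hN]
    refine sum_mem fun i hi => ?_
    refine Submodule.mem_iSup_of_mem ⟨i, ?_⟩ (LinearMap.mem_range_self _ _)
    have := (Finset.mem_Icc.mp hi).2
    omega
  | add F G hF hG =>
    obtain ⟨p, hp, hp'⟩ := hF
    obtain ⟨q, hq, hq'⟩ := hG
    refine ⟨p + q, add_mem hp hq, ?_⟩
    have : F + G - (p + q).1 = (F - p.1) + (G - q.1) := by
      rw [Prod.fst_add]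
      abel
    rw [this]
    exact add_mem hp' hq'

end Coefficients

section RootGrading

variable {g : Type*} [LieRing g] [LieAlgebra ℂ g] [Module.Finite ℂ g] [LieAlgebra.IsSimple ℂ g]
  {H : LieSubalgebra ℂ g} [H.IsCartanSubalgebra]

/-! ### Coefficients of roots -/

lemma root_apply_simplexVertex (b : (rootSystem H).Base) (k : b.support → ℕ) (α : b.support)
    (β : H.root) :
    (rootSystem H).root β (simplexVertex b k α) =
      (k α : ℂ)⁻¹ * b.toWeightBasis.repr ((rootSystem H).root β) α := by
  rw [simplexVertex, map_smul, ← Module.Basis.coord_apply, ← Module.Dual.eval_apply ℂ H,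
    ← Module.evalEquiv_toLinearMap ℂ H]
  simp

lemma repr_sum_smul_root (b : (rootSystem H).Base) (α : b.support) {R : Type*} [Semiring R]
    [Module R (Module.Dual ℂ H)] (c : R →+* ℂ)
    (hc : ∀ (r : R) (x : Module.Dual ℂ H), r • x = c r • x)
    (f : b.support → R) :
    b.toWeightBasis.repr (∑ γ : b.support, f γ • (rootSystem H).root γ) α = c (f α) := by
  classical
  simp only [hc, map_sum, map_smul, b.toWeightBasis_repr_root, Finsupp.coe_finsetSum,
    Finset.sum_apply, Finsupp.smul_apply, Finsupp.single_apply]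
  simp

lemma exists_repr_root_eq_intCast (b : (rootSystem H).Base) (α : b.support) (β : H.root) :
    ∃ n : ℤ, b.toWeightBasis.repr ((rootSystem H).root β) α = n ∧
      (b.IsPos β → 0 ≤ n) ∧ (¬ b.IsPos β → n ≤ 0) := by
  obtain ⟨f, -, hf, h⟩ := b.exists_root_eq_sum_int β
  have hh := RootPairing.Base.height_eq_sum h
  refine ⟨f α, ?_, ?_, ?_⟩
  · rw [h, ← Finset.sum_coe_sort]
    exact repr_sum_smul_root b α (Int.castRingHom ℂ)
      (fun r x => (Int.cast_smul_eq_zsmul ℂ r x).symm) (fun γ => f γ)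
  · intro hp
    rcases hf with hf | hf
    · exact hf.le _
    · rw [RootPairing.Base.isPos_iff, hh] at hp
      exact absurd hp (not_lt.mpr (Finset.sum_nonpos fun i _ => hf.le i))
  · intro hp
    rcases hf with hf | hf
    · rw [RootPairing.Base.isPos_iff', hh] at hp
      exact absurd (Finset.sum_nonneg fun i _ => hf.le i) hp
    · exact hf.le _

lemma repr_root_le_mark {b : (rootSystem H).Base} {θ : H.root} (hθ : IsHighestRoot b θ)
    {k : b.support → ℕ}
    (hk : (rootSystem H).root θ = ∑ γ : b.support, k γ • (rootSystem H).root γ)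
    (α : b.support) (β : H.root) {n : ℤ}
    (hn : b.toWeightBasis.repr ((rootSystem H).root β) α = n) : n ≤ k α := by
  classical
  have key : ∀ m ∈ AddSubmonoid.closure ((rootSystem H).root '' b.support),
      ∃ c : ℕ, b.toWeightBasis.repr m α = c := by
    intro m hm
    induction hm using AddSubmonoid.closure_induction with
    | mem m hm =>
      obtain ⟨j, hj, rfl⟩ := hm
      rw [b.toWeightBasis_repr_root ⟨j, hj⟩, Finsupp.single_apply]
      split_ifs
      · exact ⟨1, by simp⟩
      · exact ⟨0, by simp⟩
    | zero => exact ⟨0, by simp⟩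
    | add x y _ _ hx hy =>
      obtain ⟨c, hc⟩ := hx
      obtain ⟨d, hd⟩ := hy
      exact ⟨c + d, by simp [hc, hd]⟩
  obtain ⟨c, hc⟩ := key _ (hθ β)
  have hkα := repr_sum_smul_root b α (Nat.castRingHom ℂ)
    (fun r x => (Nat.cast_smul_eq_nsmul ℂ r x).symm) k
  rw [← hk] at hkα
  rw [map_sub, Finsupp.sub_apply, hkα, hn, Nat.coe_castRingHom] at hc
  have : (k α : ℤ) - n = c := by exact_mod_cast hc
  omega

lemma neg_mark_le_repr_root {b : (rootSystem H).Base} {θ : H.root} (hθ : IsHighestRoot b θ)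
    {k : b.support → ℕ}
    (hk : (rootSystem H).root θ = ∑ γ : b.support, k γ • (rootSystem H).root γ)
    (α : b.support) (β : H.root) {n : ℤ}
    (hn : b.toWeightBasis.repr ((rootSystem H).root β) α = n) : - (k α : ℤ) ≤ n := by
  -- The permutation `reflectionPerm β` sends `β` to `-β`, to which the upper bound applies.
  have h := repr_root_le_mark hθ hk α ((rootSystem H).reflectionPerm β β) (n := -n) (by
    rw [RootPairing.root_reflectionPerm, RootPairing.reflection_apply_self, map_neg,
      Finsupp.neg_apply, hn, Int.cast_neg])
  omega

/-! ### The root space decomposition -/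

omit [LieAlgebra.IsSimple ℂ g] in
lemma cartan_sup_iSup_rootSpace (H : LieSubalgebra ℂ g) [H.IsCartanSubalgebra] :
    H.toSubmodule ⊔ ⨆ β : H.root, (rootSpace H β.1).toSubmodule = ⊤ := by
  rw [eq_top_iff, ← LieSubmodule.iSup_toSubmodule_eq_top.mpr
    (LieModule.iSup_genWeightSpace_eq_top' ℂ H g)]
  refine iSup_le fun χ => ?_
  by_cases hχ : χ.IsZero
  · refine le_sup_of_le_left ?_
    rw [hχ.eq]
    exact (congrArg LieSubmodule.toSubmodule (rootSpace_zero_eq ℂ g H)).le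
  · exact le_sup_of_le_right (le_iSup_of_le ⟨χ, by simpa using hχ⟩ le_rfl)

lemma lie_eq_root_smul {β : H.root} {x : g} (hx : x ∈ rootSpace H β.1) (h : H) :
    ⁅(h : g), x⁆ = (rootSystem H).root β h • x :=
  lie_eq_smul_of_mem_rootSpace hx h

omit [LieAlgebra.IsSimple ℂ g] in
lemma killingForm_cartan_rootSpace {β : H.root} {x y : g} (hx : x ∈ H)
    (hy : y ∈ rootSpace H β.1) : killingForm ℂ g x y = 0 := by
  have hx' : x ∈ rootSpace H (0 : H → ℂ) := by
    rw [rootSpace_zero_eq ℂ g H]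
    exact hx
  refine killingForm_apply_eq_zero_of_mem_rootSpace_of_add_ne_zero ℂ g H hx' hy ?_
  rw [zero_add]
  exact (Finset.mem_filter.mp β.2).2

lemma killingForm_rootSpace_rootSpace {β γ : H.root} {x y : g} (hx : x ∈ rootSpace H β.1)
    (hy : y ∈ rootSpace H γ.1)
    (h : (rootSystem H).root β + (rootSystem H).root γ ≠ 0) : killingForm ℂ g x y = 0 := by
  refine killingForm_apply_eq_zero_of_mem_rootSpace_of_add_ne_zero ℂ g H hx hy fun h0 => h ?_
  ext z
  exact congrFun h0 z

/-- The subspace of `𝔤` spanned by the root spaces of those roots in which `α` has coefficient `n`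
and, for `n = 0`, by the Cartan subalgebra. -/
def rootGrading (b : (rootSystem H).Base) (α : b.support) (n : ℤ) : Submodule ℂ g :=
  (if n = 0 then H.toSubmodule else ⊥) ⊔ ⨆ β : H.root,
    ⨆ _ : b.toWeightBasis.repr ((rootSystem H).root β) α = n, (rootSpace H β.1).toSubmodule

variable {b : (rootSystem H).Base} {α : b.support}

lemma cartan_le_rootGrading : H.toSubmodule ≤ rootGrading b α 0 := by
  simp [rootGrading]

lemma rootSpace_le_rootGrading {β : H.root} {n : ℤ}
    (hn : b.toWeightBasis.repr ((rootSystem H).root β) α = n) :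
    (rootSpace H β.1).toSubmodule ≤ rootGrading b α n :=
  le_sup_of_le_right (le_iSup₂_of_le β hn le_rfl)

lemma rootGrading_le {n : ℤ} {N : Submodule ℂ g} (h₀ : n = 0 → H.toSubmodule ≤ N)
    (h : ∀ β : H.root, b.toWeightBasis.repr ((rootSystem H).root β) α = n →
      (rootSpace H β.1).toSubmodule ≤ N) : rootGrading b α n ≤ N := by
  refine sup_le ?_ (iSup₂_le h)
  split_ifs with hn
  · exact h₀ hn
  · exact bot_le

lemma negParabolic_eq_iSup : negParabolic b α = ⨆ n : ℤ, ⨆ _ : n ≤ 0, rootGrading b α n := by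
  apply le_antisymm
  · refine sup_le (cartan_le_rootGrading.trans (le_iSup₂_of_le 0 le_rfl le_rfl))
      (iSup₂_le fun β hβ => ?_)
    obtain ⟨n, hn, -, h⟩ := exists_repr_root_eq_intCast b α β
    refine (rootSpace_le_rootGrading hn).trans (le_iSup₂_of_le n ?_ le_rfl)
    rcases hβ with hβ | hβ
    · exact h hβ
    · rw [hn] at hβ
      exact le_of_eq (by exact_mod_cast hβ)
  · refine iSup₂_le fun n hn => rootGrading_le (fun _ => le_sup_left) fun β hβ => ?_
    refine le_sup_of_le_right (le_iSup₂_of_le β ?_ le_rfl)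
    rw [or_iff_not_imp_left, not_not]
    intro hp
    obtain ⟨m, hm, h, -⟩ := exists_repr_root_eq_intCast b α β
    have hmn : m = n := by exact_mod_cast hm.symm.trans hβ
    rw [hm]
    have := h hp
    exact_mod_cast (by omega : m = 0)

lemma iSup_rootGrading_eq_top : ⨆ n : ℤ, rootGrading b α n = ⊤ := by
  rw [eq_top_iff, ← cartan_sup_iSup_rootSpace H]
  refine sup_le (cartan_le_rootGrading.trans (le_iSup _ _)) (iSup_le fun β => ?_)
  obtain ⟨n, hn, -⟩ := exists_repr_root_eq_intCast b α β
  exact (rootSpace_le_rootGrading hn).trans (le_iSup _ n)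

lemma rootGrading_eq_bot {θ : H.root} (hθ : IsHighestRoot b θ)
    {k : b.support → ℕ}
    (hk : (rootSystem H).root θ = ∑ γ : b.support, k γ • (rootSystem H).root γ) {n : ℤ}
    (hn : (k α : ℤ) < |n|) : rootGrading b α n = ⊥ := by
  refine le_bot_iff.mp (rootGrading_le ?_ ?_)
  · rintro rfl
    simp at hn
    omega
  · intro β hβ
    have h₁ := repr_root_le_mark hθ hk α β hβ
    have h₂ := neg_mark_le_repr_root hθ hk α β hβ
    exact absurd hn (not_lt.mpr (abs_le.mpr ⟨h₂, h₁⟩))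

/-! ### The grading by the eigenvalues of the fundamental coweight -/

/-- With all marks replaced by `1`, the vertex is the fundamental coweight, which acts on `𝔤_β` by
the coefficient of `α` in `β`. The pieces lie in independent eigenspaces and span `𝔤`, so they
exhaust them. Compatibility with the bracket and the Killing form then follows from the derivation
property and invariance. -/
lemma rootGrading_eq_eigenspace (n : ℤ) :
    rootGrading b α n =
      (ad ℂ g (simplexVertex b (fun _ => 1) α : H)).eigenspace (n : ℂ) := by
  set T := ad ℂ g (simplexVertex b (fun _ => 1) α : H)
  have hle : ∀ m : ℤ, rootGrading b α m ≤ T.eigenspace (m : ℂ) := by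
    intro m
    refine rootGrading_le ?_ ?_
    · rintro rfl x hx
      rw [Module.End.mem_eigenspace_iff]
      have h0 : ⁅simplexVertex b (fun _ => 1) α, (⟨x, hx⟩ : H)⁆ = 0 := trivial_lie_zero _ _ _ _
      simpa [T] using congrArg (Subtype.val) h0
    · intro β hβ x hx
      rw [Module.End.mem_eigenspace_iff]
      have := lie_eq_root_smul hx (simplexVertex b (fun _ => 1) α)
      rw [root_apply_simplexVertex, hβ] at this
      simpa [T] using this
  have hind : iSupIndep fun m : ℤ => T.eigenspace (m : ℂ) :=
    T.eigenspaces_iSupIndep.comp Int.cast_injective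
  refine le_antisymm (hle n) ?_
  have hdis : Disjoint (T.eigenspace (n : ℂ)) (⨆ m : ℤ, ⨆ _ : m ≠ n, rootGrading b α m) :=
    (hind n).mono_right (iSup₂_mono fun m _ => hle m)
  have htop : rootGrading b α n ⊔ (⨆ m : ℤ, ⨆ _ : m ≠ n, rootGrading b α m) = ⊤ := by
    rw [eq_top_iff, ← iSup_rootGrading_eq_top (b := b) (α := α)]
    refine iSup_le fun m => ?_
    by_cases h : m = n
    · exact h ▸ le_sup_left
    · exact le_sup_of_le_right (le_iSup₂_of_le m h le_rfl)
  -- The modular law, with the remaining pieces disjoint from this eigenspace.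
  calc T.eigenspace (n : ℂ)
      = (rootGrading b α n ⊔ (⨆ m : ℤ, ⨆ _ : m ≠ n, rootGrading b α m)) ⊓ T.eigenspace (n : ℂ) := by
        rw [htop, top_inf_eq]
    _ = rootGrading b α n ⊔ (⨆ m : ℤ, ⨆ _ : m ≠ n, rootGrading b α m) ⊓ T.eigenspace (n : ℂ) :=
        sup_inf_assoc_of_le _ (hle n)
    _ ≤ rootGrading b α n := by rw [inf_comm, hdis.eq_bot, sup_bot_eq]

lemma lie_mem_rootGrading {m n : ℤ} {x y : g} (hx : x ∈ rootGrading b α m)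
    (hy : y ∈ rootGrading b α n) : ⁅x, y⁆ ∈ rootGrading b α (m + n) := by
  rw [rootGrading_eq_eigenspace, Module.End.mem_eigenspace_iff, ad_apply] at *
  rw [leibniz_lie, hx, hy]
  push_cast
  rw [smul_lie, lie_smul, add_smul]

lemma killingForm_rootGrading {m n : ℤ} (hmn : m + n ≠ 0) {x y : g} (hx : x ∈ rootGrading b α m)
    (hy : y ∈ rootGrading b α n) : killingForm ℂ g x y = 0 := by
  rw [rootGrading_eq_eigenspace, Module.End.mem_eigenspace_iff, ad_apply] at *
  have h := LieModule.traceForm_apply_lie_apply ℂ g g x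
    ((simplexVertex b (fun _ => 1) α : H) : g) y
  rw [hy, ← lie_skew, hx] at h
  simp only [map_neg, map_smul, LinearMap.neg_apply, LinearMap.smul_apply, smul_eq_mul] at h
  have hc : ((m + n : ℤ) : ℂ) ≠ 0 := by exact_mod_cast hmn
  push_cast at hc
  have : ((m : ℂ) + n) * killingForm ℂ g x y = 0 := by
    rw [killingForm]
    linear_combination -h
  exact (mul_eq_zero.mp this).resolve_left hc

end RootGrading

/-! ### Expansions of Laurent polynomials at zero and at infinity -/

lemma laurentAtZero_T (n : ℤ) : laurentAtZero (LaurentPolynomial.T n) = HahnSeries.single n 1 := by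
  rw [laurentAtZero, LaurentPolynomial.T, AddMonoidAlgebra.lift_single, one_smul]
  rfl

lemma laurentAtInfinity_T (n : ℤ) :
    laurentAtInfinity (LaurentPolynomial.T n) = HahnSeries.single (-n) 1 := by
  simp [laurentAtInfinity, laurentAtZero_T]

lemma coeff_laurentAtInfinity (p : ℂ[T;T⁻¹]) (i : ℤ) :
    (laurentAtInfinity p).coeff i = (laurentAtZero p).coeff (-i) := by
  induction p using LaurentPolynomial.induction_on' with
  | add p q hp hq => simp [hp, hq]
  | C_mul_T n a =>
    rw [← LaurentPolynomial.smul_eq_C_mul, map_smul, map_smul, laurentAtZero_T,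
      laurentAtInfinity_T, HahnSeries.coeff_smul, HahnSeries.coeff_smul, HahnSeries.coeff_single,
      HahnSeries.coeff_single]
    simp [neg_eq_iff_eq_neg]

/-! ### Which homogeneous pieces occur in each coefficient of `𝕆_α ∩ 𝔤[u, u⁻¹]` -/

section PolynomialOrder

variable {g : Type*} [LieRing g] [LieAlgebra ℂ g]

lemma currentCoeff_laurentAtInfinity (P : ℂ[T;T⁻¹] ⊗[ℂ] g) (i : ℤ) :
    currentCoeff g i (LinearMap.rTensor g laurentAtInfinity.toLinearMap P) =
      currentCoeff g (-i) (LinearMap.rTensor g laurentAtZero.toLinearMap P) := by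
  induction P using TensorProduct.induction_on with
  | zero => simp
  | tmul p x =>
    simp only [LinearMap.rTensor_tmul, AlgHom.toLinearMap_apply, currentCoeff_tmul,
      coeff_laurentAtInfinity]
  | add P Q hP hQ => simp only [map_add, hP, hQ]

variable [Module.Finite ℂ g] [LieAlgebra.IsSimple ℂ g]
  {H : LieSubalgebra ℂ g} [H.IsCartanSubalgebra]
  {b : (rootSystem H).Base} {k : b.support → ℕ} {α : b.support}

lemma map_currentCoeff_eq_zero_of_mem_maximalOrder {V : Type*} [AddCommGroup V] [Module ℂ V]
    {h : H} {i : ℤ} (φ : g →ₗ[ℂ] V)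
    (hH : i < 0 ∨ ∀ x ∈ H, φ x = 0)
    (hR : ∀ β : H.root, (i : ℝ) < ((rootSystem H).root β h).re ∨
      ∀ x ∈ rootSpace H β.1, φ x = 0)
    {G : LaurentCurrent g} (hG : G ∈ maximalOrder h) : φ (currentCoeff g i G) = 0 := by
  suffices maximalOrder h ≤ LinearMap.ker (φ ∘ₗ currentCoeff g i) from this hG
  refine sup_le (Submodule.map₂_le.mpr fun f hf x hx => ?_)
    (iSup_le fun β => Submodule.map₂_le.mpr fun f hf x hx => ?_)
  · rw [TensorProduct.mk_apply, LinearMap.mem_ker, LinearMap.comp_apply, currentCoeff_tmul,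
      map_smul]
    rcases hH with hi | hφ
    · rw [hf i (by exact_mod_cast hi), zero_smul]
    · rw [hφ x hx, smul_zero]
  · rw [TensorProduct.mk_apply, LinearMap.mem_ker, LinearMap.comp_apply, currentCoeff_tmul,
      map_smul]
    rcases hR β with hi | hφ
    · rw [hf i hi, zero_smul]
    · rw [hφ x hx, smul_zero]

/-- A linear map kills the `i`-th coefficient of the elements of `𝕆_α ∩ 𝔤[u, u⁻¹]` if it kills
all those homogeneous pieces of `𝔤` which may occur in this coefficient. -/
lemma map_currentCoeff_eq_zero_of_mem_polynomialOrder {V : Type*} [AddCommGroup V] [Module ℂ V]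
    {i : ℤ} (φ : g →ₗ[ℂ] V)
    (hH : 0 < i ∨ ∀ x ∈ H, φ x = 0)
    (hR : ∀ β : H.root, -(i : ℝ) < ((rootSystem H).root β (simplexVertex b k α)).re ∨
      ∀ x ∈ rootSpace H β.1, φ x = 0)
    {F : LaurentCurrent g} (hF : F ∈ polynomialOrder b k α) : φ (currentCoeff g i F) = 0 := by
  obtain ⟨P, hP, rfl⟩ := hF
  have := map_currentCoeff_eq_zero_of_mem_maximalOrder (i := -i) φ
    (hH.imp_left fun h => by omega) (fun β => (hR β).imp_left fun h => by exact_mod_cast h) hP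
  rwa [currentCoeff_laurentAtInfinity, neg_neg] at this

/-- Pairing with `𝔤_γ` sees only the component in `𝔤_(-γ)`. There `u^i`, of valuation `-i` at
infinity, is allowed only if `-i ≥ -γ(h_α)`. -/
lemma killingForm_currentCoeff_eq_zero {γ : H.root} {i : ℤ}
    (hi : ((rootSystem H).root γ (simplexVertex b k α)).re < i) {F : LaurentCurrent g}
    (hF : F ∈ polynomialOrder b k α) {x : g} (hx : x ∈ rootSpace H γ.1) :
    killingForm ℂ g (currentCoeff g i F) x = 0 := by
  refine map_currentCoeff_eq_zero_of_mem_polynomialOrder ((killingForm ℂ g).flip x)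
    (Or.inr fun y hy => killingForm_cartan_rootSpace hy hx) (fun β => ?_) hF
  by_cases h : (rootSystem H).root β + (rootSystem H).root γ = 0
  · left
    rw [eq_neg_of_add_eq_zero_left h, LinearMap.neg_apply, Complex.neg_re]
    linarith
  · right
    exact fun y hy => killingForm_rootSpace_rootSpace hy hx h

lemma killingForm_currentCoeff_cartan_eq_zero {i : ℤ} (hi : 0 < i) {F : LaurentCurrent g}
    (hF : F ∈ polynomialOrder b k α) {x : g} (hx : x ∈ H) :
    killingForm ℂ g (currentCoeff g i F) x = 0 := by
  refine map_currentCoeff_eq_zero_of_mem_polynomialOrder ((killingForm ℂ g).flip x)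
    (Or.inl hi) (fun β => Or.inr fun y hy => ?_) hF
  exact (LieModule.traceForm_comm ℂ g g y x).trans (killingForm_cartan_rootSpace hx hy)

lemma monomial_mem_polynomialOrder {i : ℤ} {x : g}
    (h : ((HahnSeries.single (-i) (1 : ℂ) : LaurentSeries ℂ) ⊗ₜ[ℂ] x : LaurentCurrent g) ∈
      maximalOrder (simplexVertex b k α)) :
    monomial i x ∈ polynomialOrder b k α := by
  refine ⟨LaurentPolynomial.T i ⊗ₜ x, ?_, ?_⟩
  · simpa [laurentAtInfinity_T] using h
  · simp [laurentAtZero_T, monomial_apply]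

lemma single_mem_valuationGE {r : ℝ} {i : ℤ} (h : r ≤ i) :
    (HahnSeries.single i (1 : ℂ) : LaurentSeries ℂ) ∈ valuationGE r := by
  intro n hn
  rw [HahnSeries.coeff_single, if_neg]
  rintro rfl
  linarith

lemma monomial_rootGrading_mem_polynomialOrder (hkα : k α = 1) {n i : ℤ} (hi : i ≤ -n) {x : g}
    (hx : x ∈ rootGrading b α n) : monomial i x ∈ polynomialOrder b k α := by
  suffices rootGrading b α n ≤ (polynomialOrder b k α).comap (monomial i) from this hx
  refine rootGrading_le ?_ ?_
  · rintro rfl x hx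
    refine monomial_mem_polynomialOrder (Submodule.mem_sup_left (Submodule.apply_mem_map₂ _
      (single_mem_valuationGE ?_) hx))
    exact_mod_cast (by omega : 0 ≤ -i)
  · intro β hβ x hx
    refine monomial_mem_polynomialOrder (Submodule.mem_sup_right (Submodule.mem_iSup_of_mem β
      (Submodule.apply_mem_map₂ _ (single_mem_valuationGE ?_) hx)))
    rw [root_apply_simplexVertex, hβ, hkα]
    simp only [Nat.cast_one, inv_one, one_mul, Complex.intCast_re]
    exact_mod_cast (by omega : n ≤ -i)

lemma killingForm_currentCoeff_rootGrading_eq_zero (hkα : k α = 1) {n i : ℤ} (hi : n < i)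
    {F : LaurentCurrent g} (hF : F ∈ polynomialOrder b k α) {x : g}
    (hx : x ∈ rootGrading b α n) : killingForm ℂ g (currentCoeff g i F) x = 0 := by
  suffices rootGrading b α n ≤ LinearMap.ker (killingForm ℂ g (currentCoeff g i F)) from this hx
  refine rootGrading_le ?_ ?_
  · rintro rfl x hx
    exact killingForm_currentCoeff_cartan_eq_zero hi hF hx
  · intro β hβ x hx
    refine killingForm_currentCoeff_eq_zero ?_ hF hx
    rw [root_apply_simplexVertex, hβ, hkα]
    simpa using hi

end PolynomialOrder

/-! ### Lagrangian subalgebras containing a Lagrangian subalgebra of `𝔤((u))` -/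

section Product

variable {g : Type*} [LieRing g] [LieAlgebra ℂ g]

lemma doubleForm_apply (p q : Double g) :
    doubleForm g 1 p q = residueForm g 1 p.1 q.1 - dualForm g p.2 q.2 := rfl

lemma mem_dualExtension {P : Submodule ℂ g} {z : DualCurrent g} :
    z ∈ dualExtension P ↔ dualFst z ∈ P ∧ dualSnd z ∈ (killingForm ℂ g).orthogonal P := Iff.rfl

/-- The product of two Lie subalgebras, as a subalgebra of `𝔤((u)) ⊕ 𝔤[ε]`. -/
def prodSubalgebra (X : LieSubalgebra ℂ (LaurentCurrent g)) (V : LieSubalgebra ℂ (DualCurrent g)) :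
    LieSubalgebra ℂ (Double g) where
  toSubmodule := X.toSubmodule.prod V.toSubmodule
  lie_mem' hp hq := ⟨X.lie_mem hp.1 hq.1, V.lie_mem hp.2 hq.2⟩

lemma mem_prodSubalgebra {X : LieSubalgebra ℂ (LaurentCurrent g)}
    {V : LieSubalgebra ℂ (DualCurrent g)} {p : Double g} :
    p ∈ prodSubalgebra X V ↔ p.1 ∈ X ∧ p.2 ∈ V := Iff.rfl

lemma map_snd_prodSubalgebra (X : LieSubalgebra ℂ (LaurentCurrent g))
    (V : LieSubalgebra ℂ (DualCurrent g)) :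
    (prodSubalgebra X V).map (LieHom.snd ℂ (LaurentCurrent g) (DualCurrent g)) = V := by
  ext z
  rw [LieSubalgebra.mem_map]
  exact ⟨fun ⟨p, hp, h⟩ => h ▸ hp.2, fun h => ⟨(0, z), ⟨zero_mem _, h⟩, rfl⟩⟩

variable {X : LieSubalgebra ℂ (LaurentCurrent g)}

lemma isLagrangian_prodSubalgebra_iff (hX : IsLagrangian (residueForm g 1) X)
    {V : LieSubalgebra ℂ (DualCurrent g)} :
    IsLagrangian (doubleForm g 1) (prodSubalgebra X V) ↔ IsLagrangian (dualForm g) V := by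
  have hX' : ∀ F, (∀ G ∈ X, residueForm g 1 G F = 0) ↔ F ∈ X := fun F =>
    Submodule.ext_iff.mp hX F
  constructor
  · intro h
    ext z
    have hz : _ ↔ (0, z) ∈ (prodSubalgebra X V) := Submodule.ext_iff.mp h (0, z)
    have hz' : z ∈ V.toSubmodule ↔ ((0 : LaurentCurrent g), z) ∈ prodSubalgebra X V :=
      ⟨fun h => ⟨zero_mem _, h⟩, fun h => h.2⟩
    rw [hz', ← hz]
    constructor
    · intro h p hp
      have := h p.2 hp.2
      simp [doubleForm_apply] at this ⊢
      exact this
    · intro h w hw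
      have := h (0, w) ⟨zero_mem _, hw⟩
      simpa [doubleForm_apply] using this
  · intro h
    have hV : ∀ z, (∀ w ∈ V, dualForm g w z = 0) ↔ z ∈ V := fun z =>
      Submodule.ext_iff.mp h z
    ext p
    constructor
    · intro hp
      refine ⟨(hX' _).mp fun G hG => ?_, (hV _).mp fun w hw => ?_⟩
      · have := hp (G, 0) ⟨hG, zero_mem _⟩
        simpa [doubleForm_apply] using this
      · have := hp (0, w) ⟨zero_mem _, hw⟩
        simpa [doubleForm_apply] using this
    · intro hp q hq
      rw [doubleForm_apply, (hX' _).mpr hp.1 _ hq.1, (hV _).mpr hp.2 _ hq.2,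
        sub_zero]

/-- `W ⊆ X ⊕ 𝔤[ε]` gives `X^⊥ ⊕ 0 ⊆ W^⊥ = W`. Both parts of the theorem rest on this. -/
lemma mem_of_forall_residueForm_eq_zero {W : LieSubalgebra ℂ (Double g)}
    (hW : IsLagrangian (doubleForm g 1) W) {X : Submodule ℂ (LaurentCurrent g)}
    (hWX : W.toSubmodule ≤ X.prod ⊤) {F : LaurentCurrent g}
    (hF : ∀ G ∈ X, residueForm g 1 G F = 0) : (F, 0) ∈ W := by
  have h : (F, 0) ∈ (doubleForm g 1).orthogonal W.toSubmodule := by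
    intro p hp
    simpa [doubleForm_apply] using hF p.1 (hWX hp).1
  rw [hW] at h
  exact h

lemma eq_prodSubalgebra (hX : IsLagrangian (residueForm g 1) X) {W : LieSubalgebra ℂ (Double g)}
    (hW : IsLagrangian (doubleForm g 1) W) (hWX : W.toSubmodule ≤ X.toSubmodule.prod ⊤) :
    W = prodSubalgebra X (W.map (LieHom.snd ℂ (LaurentCurrent g) (DualCurrent g))) := by
  have hX' : ∀ F ∈ X, (F, (0 : DualCurrent g)) ∈ W := fun F hF => by
    refine mem_of_forall_residueForm_eq_zero hW hWX ?_
    have : F ∈ X.toSubmodule := hF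
    rw [← hX] at this
    exact this
  ext p
  rw [mem_prodSubalgebra, LieSubalgebra.mem_map]
  constructor
  · exact fun hp => ⟨(hWX hp).1, p, hp, rfl⟩
  · rintro ⟨hp, q, hq, h⟩
    -- `p` and `q` have the same second component, so `p - q` lies in `X ⊕ 0 ⊆ W`.
    have := add_mem hq (hX' _ (sub_mem hp (hWX hq).1))
    convert this using 1
    refine Prod.ext ?_ ?_
    · simp
    · simpa using h.symm

/-- Transversality of `X ⊕ V` to a subspace `Δ` is transversality of `V` to the projection of
`Δ ∩ (X ⊕ 𝔤[ε])`, if `X` and the first components of `Δ` span everything and `Δ` meets `X`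
trivially. -/
lemma isTransversal_prodSubalgebra_iff {V : LieSubalgebra ℂ (DualCurrent g)}
    {Δ : Submodule ℂ (Double g)} {T : Submodule ℂ (DualCurrent g)}
    (h₁ : ∀ F ∈ X, ∀ z, (F, z) ∈ Δ → z ∈ T)
    (h₂ : ∀ z ∈ T, ∃ F ∈ X, (F, z) ∈ Δ)
    (h₃ : ∀ F, ∃ p ∈ Δ, F - p.1 ∈ X)
    (h₄ : ∀ F ∈ X, (F, 0) ∈ Δ → F = 0) :
    IsTransversal (prodSubalgebra X V) Δ ↔ IsTransversal V T := by
  constructor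
  · rintro ⟨hd, hc⟩
    rw [Submodule.disjoint_def] at hd
    rw [codisjoint_iff] at hc
    refine ⟨Submodule.disjoint_def.mpr fun z hzV hzT => ?_, codisjoint_iff.mpr ?_⟩
    · obtain ⟨F, hF, hFz⟩ := h₂ z hzT
      exact congrArg Prod.snd (hd (F, z) ⟨hF, hzV⟩ hFz)
    · refine eq_top_iff.mpr fun z _ => ?_
      obtain ⟨p, hp, q, hq, h⟩ := Submodule.mem_sup.mp
        (hc ▸ Submodule.mem_top : ((0 : LaurentCurrent g), z) ∈ _)
      refine Submodule.mem_sup.mpr ⟨p.2, hp.2, q.2, h₁ q.1 ?_ q.2 hq, congrArg Prod.snd h⟩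
      refine (add_mem_cancel_left (H := X.toSubmodule) hp.1).mp ?_
      rw [show p.1 + q.1 = 0 from congrArg Prod.fst h]
      exact zero_mem _
  · rintro ⟨hd, hc⟩
    rw [Submodule.disjoint_def] at hd
    rw [codisjoint_iff] at hc
    refine ⟨Submodule.disjoint_def.mpr fun p hpV hpΔ => ?_, codisjoint_iff.mpr ?_⟩
    · have hp2 := hd p.2 hpV.2 (h₁ p.1 hpV.1 p.2 hpΔ)
      have hp : p = (p.1, 0) := Prod.ext rfl hp2
      exact Prod.ext (h₄ p.1 hpV.1 ((congrArg (· ∈ Δ) hp).mp hpΔ)) hp2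
    · refine eq_top_iff.mpr fun p _ => ?_
      obtain ⟨q, hq, hpq⟩ := h₃ p.1
      obtain ⟨v, hv, t, ht, h⟩ := Submodule.mem_sup.mp
        (hc ▸ Submodule.mem_top : p.2 - q.2 ∈ _)
      obtain ⟨F, hF, hFt⟩ := h₂ t ht
      refine Submodule.mem_sup.mpr ⟨(p.1 - q.1 - F, v), ⟨sub_mem hpq hF, hv⟩, q + (F, t),
        add_mem hq hFt, Prod.ext ?_ ?_⟩
      · simp
      · rw [Prod.snd_add, Prod.snd_add, add_left_comm, h, add_sub_cancel]

end Product

section RootFiltration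

variable {g : Type*} [LieRing g] [LieAlgebra ℂ g] [Module.Finite ℂ g] [LieAlgebra.IsSimple ℂ g]
  {H : LieSubalgebra ℂ g} [H.IsCartanSubalgebra]

/-! ### The filtration by the coefficient of `α` -/

/-- The sum of the graded pieces of `𝔤` of degree at most `j`. -/
def rootFiltration (b : (rootSystem H).Base) (α : b.support) (j : ℤ) : Submodule ℂ g :=
  ⨆ n : ℤ, ⨆ _ : n ≤ j, rootGrading b α n

variable {b : (rootSystem H).Base} {α : b.support}

lemma rootGrading_le_rootFiltration {n j : ℤ} (h : n ≤ j) :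
    rootGrading b α n ≤ rootFiltration b α j :=
  le_iSup₂_of_le n h le_rfl

lemma eq_zero_of_forall_rootGrading {y : g}
    (h : ∀ n, ∀ x ∈ rootGrading b α n, killingForm ℂ g y x = 0) : y = 0 := by
  refine (killingForm_nondegenerate ℂ g).1 y fun x => ?_
  suffices (⊤ : Submodule ℂ g) ≤ LinearMap.ker (killingForm ℂ g y) from this trivial
  rw [← iSup_rootGrading_eq_top (b := b) (α := α)]
  exact iSup_le h

/-- This is `F_j = (F_(-j-1))^⊥`. Degrees `m` and `n` are orthogonal unless `m + n = 0`; so the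
component of `y` in degrees above `j` is orthogonal to all of `𝔤`, hence zero. -/
lemma mem_rootFiltration_iff {j : ℤ} {y : g} :
    y ∈ rootFiltration b α j ↔
      ∀ n < -j, ∀ x ∈ rootGrading b α n, killingForm ℂ g y x = 0 := by
  have hle : ∀ y ∈ rootFiltration b α j,
      ∀ n < -j, ∀ x ∈ rootGrading b α n, killingForm ℂ g y x = 0 := by
    intro y hy n hn x hx
    suffices rootFiltration b α j ≤ LinearMap.ker ((killingForm ℂ g).flip x) from this hy
    exact iSup₂_le fun m hm z hz => killingForm_rootGrading (by omega) hz hx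
  refine ⟨hle y, fun h => ?_⟩
  have htop : rootFiltration b α j ⊔ ⨆ n : ℤ, ⨆ _ : j < n, rootGrading b α n = ⊤ := by
    rw [eq_top_iff, ← iSup_rootGrading_eq_top (b := b) (α := α)]
    refine iSup_le fun n => ?_
    rcases le_or_gt n j with hn | hn
    · exact le_sup_of_le_left (rootGrading_le_rootFiltration hn)
    · exact le_sup_of_le_right (le_iSup₂_of_le n hn le_rfl)
  obtain ⟨y₁, h₁, y₂, h₂, rfl⟩ := Submodule.mem_sup.mp (htop ▸ Submodule.mem_top : y ∈ _)
  suffices y₂ = 0 by rwa [this, add_zero]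
  refine eq_zero_of_forall_rootGrading (b := b) (α := α) fun n x hx => ?_
  by_cases hn : n < -j
  · have := h n hn x hx
    rwa [map_add, LinearMap.add_apply, hle y₁ h₁ n hn x hx, zero_add] at this
  · suffices (⨆ n : ℤ, ⨆ _ : j < n, rootGrading b α n) ≤
      LinearMap.ker ((killingForm ℂ g).flip x) from this h₂
    exact iSup₂_le fun m hm z hz => killingForm_rootGrading (by omega) hz hx

lemma killingForm_rootFiltration {i j : ℤ} (h : i + j < 0) {x y : g}
    (hx : x ∈ rootFiltration b α i) (hy : y ∈ rootFiltration b α j) : killingForm ℂ g x y = 0 := by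
  suffices rootFiltration b α j ≤ LinearMap.ker (killingForm ℂ g x) from this hy
  exact iSup₂_le fun n hn z hz => mem_rootFiltration_iff.mp hx n (by omega) z hz

lemma lie_mem_rootFiltration {i j : ℤ} {x y : g}
    (hx : x ∈ rootFiltration b α i) (hy : y ∈ rootFiltration b α j) :
    ⁅x, y⁆ ∈ rootFiltration b α (i + j) := by
  suffices rootFiltration b α j ≤ (rootFiltration b α (i + j)).comap (ad ℂ g x) from this hy
  refine iSup₂_le fun n hn z hz => ?_
  suffices rootFiltration b α i ≤ (rootFiltration b α (i + j)).comap (ad ℂ g z) by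
    rw [Submodule.mem_comap, ad_apply, ← lie_skew]
    exact neg_mem (this hx)
  exact iSup₂_le fun m hm w hw =>
    rootGrading_le_rootFiltration (by omega : n + m ≤ i + j) (lie_mem_rootGrading hz hw)

lemma negParabolic_eq_rootFiltration : negParabolic b α = rootFiltration b α 0 :=
  negParabolic_eq_iSup

lemma orthogonal_negParabolic :
    (killingForm ℂ g).orthogonal (negParabolic b α) = rootFiltration b α (-1) := by
  rw [negParabolic_eq_rootFiltration]
  ext y
  rw [mem_rootFiltration_iff]
  constructor
  · intro h n hn x hx
    rw [LieModule.traceForm_comm]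
    exact h x (rootGrading_le_rootFiltration (by omega) hx)
  · intro h x hx
    exact killingForm_rootFiltration (by omega) hx (mem_rootFiltration_iff.mpr h)

section Mark

variable {θ : H.root} {k : b.support → ℕ}

lemma rootFiltration_eq_top (hθ : IsHighestRoot b θ)
    (hk : (rootSystem H).root θ = ∑ γ : b.support, k γ • (rootSystem H).root γ) {j : ℤ}
    (hj : k α ≤ j) : rootFiltration b α j = ⊤ := by
  rw [eq_top_iff, ← iSup_rootGrading_eq_top (b := b) (α := α)]
  refine iSup_le fun n => ?_
  by_cases hn : n ≤ j
  · exact rootGrading_le_rootFiltration hn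
  · rw [rootGrading_eq_bot hθ hk (by rw [lt_abs]; omega)]
    exact bot_le

lemma rootFiltration_eq_bot (hθ : IsHighestRoot b θ)
    (hk : (rootSystem H).root θ = ∑ γ : b.support, k γ • (rootSystem H).root γ) {j : ℤ}
    (hj : j < -k α) : rootFiltration b α j = ⊥ := by
  refine le_bot_iff.mp (iSup₂_le fun n hn => ?_)
  rw [rootGrading_eq_bot hθ hk (by rw [lt_abs]; omega)]

/-! ### The order `𝕆_α ∩ 𝔤[u, u⁻¹]` for a root of mark one -/

lemma monomial_mem_polynomialOrder_of_mem_rootFiltration (hkα : k α = 1) {i : ℤ} {x : g}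
    (hx : x ∈ rootFiltration b α (-i)) : monomial i x ∈ polynomialOrder b k α := by
  suffices rootFiltration b α (-i) ≤ (polynomialOrder b k α).comap (monomial i) from this hx
  exact iSup₂_le fun n hn z hz => monomial_rootGrading_mem_polynomialOrder hkα (by omega) hz

lemma currentCoeff_mem_rootFiltration (hkα : k α = 1) {F : LaurentCurrent g}
    (hF : F ∈ polynomialOrder b k α) (i : ℤ) : currentCoeff g i F ∈ rootFiltration b α (-i) :=
  mem_rootFiltration_iff.mpr fun _ hn _ hx =>
    killingForm_currentCoeff_rootGrading_eq_zero hkα (by omega) hF hx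

variable (hθ : IsHighestRoot b θ)
  (hk : (rootSystem H).root θ = ∑ γ : b.support, k γ • (rootSystem H).root γ) (hkα : k α = 1)
include hθ hk hkα

lemma exists_sum_monomial_of_mem_rootFiltration {F : LaurentCurrent g}
    (hF : ∀ i, currentCoeff g i F ∈ rootFiltration b α (-i)) :
    ∃ N : ℤ, F = ∑ i ∈ Finset.Icc N 1, monomial i (currentCoeff g i F) :=
  exists_sum_monomial F 1 fun i hi => by
    have := hF i
    rwa [rootFiltration_eq_bot hθ hk (by omega), Submodule.mem_bot] at this

/-- For the converse, `F_(-i) = 0` when `i > 1`, so the coefficient condition already makes `F` a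
finite sum of monomials of the order. -/
lemma mem_polynomialOrder_iff {F : LaurentCurrent g} :
    F ∈ polynomialOrder b k α ↔ ∀ i, currentCoeff g i F ∈ rootFiltration b α (-i) := by
  refine ⟨currentCoeff_mem_rootFiltration hkα, fun h => ?_⟩
  obtain ⟨N, hN⟩ := exists_sum_monomial_of_mem_rootFiltration hθ hk hkα h
  rw [hN]
  exact sum_mem fun i _ => monomial_mem_polynomialOrder_of_mem_rootFiltration hkα (h i)

lemma lie_mem_polynomialOrder {F G : LaurentCurrent g} (hF : F ∈ polynomialOrder b k α)
    (hG : G ∈ polynomialOrder b k α) : ⁅F, G⁆ ∈ polynomialOrder b k α := by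
  rw [mem_polynomialOrder_iff hθ hk hkα] at hF hG
  obtain ⟨N, hN⟩ := exists_sum_monomial_of_mem_rootFiltration hθ hk hkα hF
  obtain ⟨M, hM⟩ := exists_sum_monomial_of_mem_rootFiltration hθ hk hkα hG
  rw [hN, hM]
  refine (congrArg (· ∈ polynomialOrder b k α) (sum_lie_sum (Finset.Icc N 1) (Finset.Icc M 1)
    (fun i => monomial i (currentCoeff g i F)) (fun j => monomial j (currentCoeff g j G)))).mpr ?_
  refine sum_mem fun i _ => sum_mem fun j _ => ?_
  rw [lie_monomial]
  refine monomial_mem_polynomialOrder_of_mem_rootFiltration hkα ?_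
  rw [neg_add]
  exact lie_mem_rootFiltration (hF i) (hG j)

/-- For a simple root of mark one, `𝕆_α ∩ 𝔤[u, u⁻¹]` is a Lie subalgebra of `𝔤((u))`. -/
def polynomialOrderSubalgebra : LieSubalgebra ℂ (LaurentCurrent g) where
  toSubmodule := polynomialOrder b k α
  lie_mem' := lie_mem_polynomialOrder hθ hk hkα

/-- Degrees `i` and `1 - i` are paired, where the coefficients range over `F_(-i)` and `F_(i-1)`;
these are exact orthogonals of each other. -/
lemma isLagrangian_polynomialOrder :
    IsLagrangian (residueForm g 1) (polynomialOrderSubalgebra hθ hk hkα) := by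
  ext F
  constructor
  · intro hF
    refine (mem_polynomialOrder_iff hθ hk hkα).mpr fun i =>
      mem_rootFiltration_iff.mpr fun n hn x hx => ?_
    have := hF _ (monomial_rootGrading_mem_polynomialOrder hkα (by omega : 1 - i ≤ -n) hx)
    rwa [residueForm_comm, residueForm_monomial, sub_sub_cancel] at this
  · intro hF G hG
    have hF' := (mem_polynomialOrder_iff hθ hk hkα).mp hF
    have hG' := (mem_polynomialOrder_iff hθ hk hkα).mp hG
    obtain ⟨N, hN⟩ := exists_sum_monomial_of_mem_rootFiltration hθ hk hkα hF'
    rw [hN, map_sum]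
    refine Finset.sum_eq_zero fun i _ => ?_
    rw [residueForm_monomial]
    exact killingForm_rootFiltration (by omega) (hG' _) (hF' i)

lemma isTransversal_prod_polynomialOrder_iff {V : LieSubalgebra ℂ (DualCurrent g)} :
    IsTransversal (prodSubalgebra (polynomialOrderSubalgebra hθ hk hkα) V)
      (powerSeriesCurrent g) ↔ IsTransversal V (dualExtension (negParabolic b α)) := by
  have hmem : ∀ {F}, F ∈ polynomialOrderSubalgebra hθ hk hkα ↔
      ∀ i, currentCoeff g i F ∈ rootFiltration b α (-i) :=
    mem_polynomialOrder_iff hθ hk hkα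
  have hT : ∀ {z : DualCurrent g}, z ∈ dualExtension (negParabolic b α) ↔
      dualFst z ∈ rootFiltration b α 0 ∧ dualSnd z ∈ rootFiltration b α (-1) := by
    intro z
    rw [mem_dualExtension, orthogonal_negParabolic, negParabolic_eq_rootFiltration]
  refine isTransversal_prodSubalgebra_iff ?_ ?_ ?_ ?_
  · intro F hF z hz
    obtain ⟨-, h₀, h₁⟩ := coeffs_of_mem_powerSeriesCurrent hz
    rw [hT, ← h₀, ← h₁]
    exact ⟨hmem.mp hF 0, hmem.mp hF 1⟩
  · intro z hz
    rw [hT] at hz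
    refine ⟨_, add_mem (S := Submodule ℂ (LaurentCurrent g)) (s := polynomialOrder b k α) ?_ ?_,
      monomial_add_monomial_mem_powerSeriesCurrent z⟩
    · exact monomial_mem_polynomialOrder_of_mem_rootFiltration hkα (by simpa using hz.1)
    · exact monomial_mem_polynomialOrder_of_mem_rootFiltration hkα hz.2
  · intro F
    obtain ⟨p, hp, hFp⟩ := exists_mem_powerSeriesCurrent F
    refine ⟨p, hp, ?_⟩
    suffices (⨆ i : {i : ℤ // i < 0}, LinearMap.range (monomial (g := g) i)) ≤
      polynomialOrder b k α from this hFp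
    refine iSup_le fun i => ?_
    rintro - ⟨x, rfl⟩
    refine monomial_mem_polynomialOrder_of_mem_rootFiltration hkα ?_
    -- For `i < 0` the index `-i` is at least the mark `1`, so the principal part is unrestricted.
    rw [rootFiltration_eq_top hθ hk (by have := i.2; omega)]
    trivial
  · intro F hF hF0
    obtain ⟨hneg, h₀, h₁⟩ := coeffs_of_mem_powerSeriesCurrent hF0
    refine current_ext fun i => ?_
    rw [map_zero]
    rcases lt_or_ge i 0 with hi | hi
    · exact hneg i hi
    rcases eq_or_ne i 0 with rfl | hi0
    · rw [h₀, map_zero]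
    rcases eq_or_ne i 1 with rfl | hi1
    · rw [h₁, map_zero]
    -- Now `i ≥ 2`, below the lowest degree `-1` of the grading.
    have := hmem.mp hF i
    rwa [rootFiltration_eq_bot hθ hk (by omega), Submodule.mem_bot] at this

end Mark

/-! ### Simple roots of mark greater than one -/

/-- The witness is a constant current `x ∈ 𝔤_α`. It is excluded because `α(h_α) = 1/k > 0`. It is
orthogonal to the order because its partner `u 𝔤_(-α)` would need `1 ≤ 1/k`. -/
lemma exists_not_mem_polynomialOrder {k : b.support → ℕ} (hkα : 1 < k α) :
    ∃ F : LaurentCurrent g, F ∉ polynomialOrder b k α ∧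
      ∀ G ∈ polynomialOrder b k α, residueForm g 1 G F = 0 := by
  have hα : ((rootSystem H).root α (simplexVertex b k α)).re = (k α : ℝ)⁻¹ := by
    rw [root_simplexVertex_self, ← Complex.ofReal_natCast, ← Complex.ofReal_inv, Complex.ofReal_re]
  have hk0 : (0 : ℝ) < (k α : ℝ)⁻¹ := by
    have : (0 : ℝ) < k α := by exact_mod_cast (by omega : 0 < k α)
    positivity
  have hk1 : (k α : ℝ)⁻¹ < 1 := inv_lt_one_of_one_lt₀ (by exact_mod_cast hkα)
  obtain ⟨x, hx, hx0⟩ := (α : H.root).1.exists_ne_zero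
  refine ⟨monomial 0 x, fun hmem => hx0 ?_, fun G hG => ?_⟩
  -- If the constant `x` were in the order, it would be orthogonal to `𝔤_(-α)`, hence in the kernel
  -- of the Killing form.
  · refine (killingForm_nondegenerate ℂ g).1 x fun y => ?_
    have h := mem_ker_killingForm_of_mem_rootSpace_of_forall_rootSpace_neg ℂ g H hx ?_
    · rw [LinearMap.mem_ker.mp h, LinearMap.zero_apply]
    intro y hy
    let γ : H.root := (rootSystem H).reflectionPerm α α
    have hγ : (rootSystem H).root γ = -(rootSystem H).root α := by
      rw [RootPairing.root_reflectionPerm, RootPairing.reflection_apply_self]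
    have hγ' : (γ.1 : H → ℂ) = -((α : H.root).1 : H → ℂ) := by
      ext z
      exact LinearMap.congr_fun hγ z
    rw [← hγ'] at hy
    have := killingForm_currentCoeff_eq_zero (i := 0) ?_ hmem hy
    · rwa [currentCoeff_monomial, if_pos rfl] at this
    · rw [hγ, LinearMap.neg_apply, Complex.neg_re, hα]
      simpa using hk0
  · rw [residueForm_monomial]
    refine killingForm_currentCoeff_eq_zero ?_ hG hx
    rw [hα]
    simpa using hk1

end RootFiltration

end PolyBialg

end

/-! ### The classification theorem -/

open PolyBialg LieAlgebra.IsKilling in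
theorem theorem4p3 {g : Type*} [LieRing g] [LieAlgebra ℂ g] [Module.Finite ℂ g]
    [LieAlgebra.IsSimple ℂ g]
    (H : LieSubalgebra ℂ g) [H.IsCartanSubalgebra]
    (b : (rootSystem H).Base)
    (θ : H.root) (hθ : IsHighestRoot b θ)
    (k : b.support → ℕ)
    (hk : (rootSystem H).root θ = ∑ γ : b.support, k γ • (rootSystem H).root γ)
    (α : b.support) :
    (k α = 1 →
      Set.BijOn (fun W : LieSubalgebra ℂ (Double g) =>
          W.map (LieHom.snd ℂ (LaurentCurrent g) (DualCurrent g)))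
        {W | IsLagrangian (doubleForm g 1) W ∧ IsTransversal W (powerSeriesCurrent g) ∧
          W.toSubmodule ≤ (polynomialOrder b k α).prod ⊤}
        {V | IsLagrangian (dualForm g) V ∧ IsTransversal V (dualExtension (negParabolic b α))}) ∧
    (1 < k α →
      ¬ ∃ W : LieSubalgebra ℂ (Double g),
        IsLagrangian (doubleForm g 1) W ∧ IsTransversal W (powerSeriesCurrent g) ∧
          W.toSubmodule ≤ (polynomialOrder b k α).prod ⊤) := by
  refine ⟨fun hkα => ?_, fun hkα => ?_⟩
  · let X := polynomialOrderSubalgebra hθ hk hkα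
    have hX := isLagrangian_polynomialOrder hθ hk hkα
    have key : ∀ W : LieSubalgebra ℂ (Double g), IsLagrangian (doubleForm g 1) W ∧
        IsTransversal W (powerSeriesCurrent g) ∧
        W.toSubmodule ≤ (polynomialOrder b k α).prod ⊤ → W = prodSubalgebra X
          (W.map (LieHom.snd ℂ (LaurentCurrent g) (DualCurrent g))) :=
      fun W hW => eq_prodSubalgebra hX hW.1 hW.2.2
    refine ⟨fun W hW => ?_, fun W₁ hW₁ W₂ hW₂ h => ?_, fun V hV => ?_⟩
    · have hW' := hW
      rw [Set.mem_ofPred_eq, key W hW] at hW'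
      exact ⟨(isLagrangian_prodSubalgebra_iff hX).mp hW'.1,
        (isTransversal_prod_polynomialOrder_iff hθ hk hkα).mp hW'.2.1⟩
    · rw [key W₁ hW₁, key W₂ hW₂]
      exact congrArg (prodSubalgebra X) h
    · exact ⟨prodSubalgebra X V, ⟨(isLagrangian_prodSubalgebra_iff hX).mpr hV.1,
        (isTransversal_prod_polynomialOrder_iff hθ hk hkα).mpr hV.2, fun p hp => ⟨hp.1, trivial⟩⟩,
        map_snd_prodSubalgebra X V⟩
  · rintro ⟨W, hW, -, hWX⟩
    obtain ⟨F, hF, hFX⟩ := exists_not_mem_polynomialOrder (b := b) (k := k) (α := α) hkα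
    exact hF (hWX (mem_of_forall_residueForm_eq_zero hW hWX hFX)).1
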